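/- Let $\Omega=(0,1)\times(0,1)$, $\sigma>0$ and $0<w<1/2$. Write $|x|_\infty=\max(|x_1|,|x_2|)$, $|x|$ for the Euclidean norm on $\mathbb{R}^2$, $\|\cdot\|$ for the norm of $L^2(\Omega)$, and $$G_\sigma(x)=\sigma^{-2}e^{-|x|^2/(2\sigma^2)},\qquad \alpha_w=\frac1{2\pi}\int_{|x|_\infty<w}G_\sigma(x)\,dx .$$ For $u\in L^2(\Omega)$, extended by zero outside $\Omega$, the restricted Gaussian blurring operator is $$(K^{\sigma,w}u)(x)=\frac{\alpha_w^{-1}}{2\pi}\int_{|x-y|_\infty<w}G_\sigma(x-y)\,u(y)\,dy,\qquad x\in\Omega .$$ For $n\ge1$ and $h=1/n$, partition $\Omega$ (up to a null set) into the $n^2$ squares $R_k$ of side $h$ of the uniform grid, with centers $z_k$, and let $U_h$ be the space of functions that are constant on each $R_k$. Put $$w_h=\left(\left\lceil \tfrac wh-\tfrac12\right\rceil+\tfrac12\right)h,\qquad N_k=\{l:\ \mathrm{Int}(R_l)\cap\{y\in\Omega:|y-z_k|_\infty<w\}\neq\emptyset\},\qquad \gamma_{kl}=\frac{h^2}{2\pi\alpha_{w_h}}G_\sigma(z_k-z_l),$$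 and define $K_h:U_h\to U_h$ by $$(K_hu)(z_k)=(1+\eta)\sum_{l\in N_k}\gamma_{kl}\,u(z_l),$$ where the number $\eta$ (depending on $\sigma,w,h$) is chosen so that $(1+\eta)\sum_{l\in N_k}\gamma_{kl}=1$ for all $k$ for which $\{y\in\mathbb{R}^2:|y-z_k|_\infty<w_h\}\subseteq\Omega$. Theorem. There are constants $C>0$ and $h_0>0$, depending only on $\sigma$ and $w$, such that for all $h=1/n\le h_0$ there is exactly one such $\eta$, and $$\|(K^{\sigma,w}-K_h)u\|\le C\,h\,\|u\|\quad\text{and}\quad \|K_hu\|_{L^\infty(\Omega)}\le C\,\|u\|\qquad\text{for all }u\in U_h .$$ Consequently, for every sequence of such grids with sizes $h_j\le h_0$, the operators $K=K^{\sigma,w}$ and $K_j=K_{h_j}$ satisfy parts [b] and [c] of the smoothed approximation condition (SAC) with the constant $C$, which is independent of $j$: for all $j\in\mathbb{N}$ and all $u\in U_{h_j}$, [b] $\|Ku-K_ju\|\le C\,h_j\,\|u\|$ and [c] $\|K_ju\|_{L^\infty(\Omega)}\le C\,\|u\|$. -/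

import Mathlib

open MeasureTheory
open scoped ENNReal

noncomputable section

namespace GaussianBlur

/-- The domain `Ω = (0,1) × (0,1)`. The plane is `ℝ × ℝ`, whose Mathlib norm is the maximum norm
`|x|_∞ = max |x₁| |x₂|`. -/
def unitSquare : Set (ℝ × ℝ) := Set.Ioo 0 1 ×ˢ Set.Ioo 0 1

/-- Lebesgue measure on `Ω`. -/
def areaΩ : Measure (ℝ × ℝ) := volume.restrict unitSquare

/-- `G_σ(x) = σ⁻² exp (-|x|² / (2 σ²))`, where `|x|` is the Euclidean norm. -/
def gauss (σ : ℝ) (x : ℝ × ℝ) : ℝ :=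
  (σ ^ 2)⁻¹ * Real.exp (-(x.1 ^ 2 + x.2 ^ 2) / (2 * σ ^ 2))

/-- `α_w = (2π)⁻¹ ∫_{|x|_∞ < w} G_σ(x) dx`. -/
def alpha (σ w : ℝ) : ℝ :=
  (2 * Real.pi)⁻¹ * ∫ x in {x : ℝ × ℝ | ‖x‖ < w}, gauss σ x

/-- The restricted Gaussian blurring operator `K^{σ,w}` for functions on `Ω`: `u` is extended by
zero outside `Ω`, and
`(K^{σ,w} u)(x) = α_w⁻¹ (2π)⁻¹ ∫_{|x - y|_∞ < w} G_σ(x - y) u(y) dy`.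
Its restriction to `Ω` is what the norms below see, as they are taken with respect to `areaΩ`. -/
def blur (σ w : ℝ) (u : ℝ × ℝ → ℝ) (x : ℝ × ℝ) : ℝ :=
  (alpha σ w)⁻¹ * (2 * Real.pi)⁻¹ *
    ∫ y in {y : ℝ × ℝ | ‖x - y‖ < w}, gauss σ (x - y) * unitSquare.indicator u y

/-- The grid size `h = 1/n` of the uniform `n × n` grid on `Ω`. -/
def gridSize (n : ℕ) : ℝ := 1 / (n : ℝ)

/-- The interior of the square `R_k` of the uniform `n × n` grid, of side `h = 1/n`. -/
def cell (n : ℕ) (k : Fin n × Fin n) : Set (ℝ × ℝ) :=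
  Set.Ioo ((k.1 : ℝ) * gridSize n) (((k.1 : ℝ) + 1) * gridSize n) ×ˢ
    Set.Ioo ((k.2 : ℝ) * gridSize n) (((k.2 : ℝ) + 1) * gridSize n)

/-- The node `z_k`, the center of `R_k`. -/
def node (n : ℕ) (k : Fin n × Fin n) : ℝ × ℝ :=
  (((k.1 : ℝ) + 1 / 2) * gridSize n, ((k.2 : ℝ) + 1 / 2) * gridSize n)

/-- The piecewise constant function with the value `c k` on the square `R_k`, for every `k`
(and, by convention, `0` on the grid lines, a null set, and outside `Ω`). -/
def stepFunction (n : ℕ) : (Fin n × Fin n → ℝ) →ₗ[ℝ] (ℝ × ℝ → ℝ) where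
  toFun c x := ∑ k, (cell n k).indicator (fun _ => c k) x
  map_add' c d := by
    funext x
    simp only [Pi.add_apply, ← Finset.sum_add_distrib]
    exact Finset.sum_congr rfl fun k _ => by by_cases h : x ∈ cell n k <;> simp [h]
  map_smul' a c := by
    funext x
    simp only [Pi.smul_apply, smul_eq_mul, RingHom.id_apply, Finset.mul_sum]
    exact Finset.sum_congr rfl fun k _ => by by_cases h : x ∈ cell n k <;> simp [h]

/-- The space `U_h` of piecewise constant functions on the uniform grid with `h = 1/n`. -/
def piecewiseConstant (n : ℕ) : Submodule ℝ (ℝ × ℝ → ℝ) := LinearMap.range (stepFunction n)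

open Classical in
/-- The index set `N_k`: all `l` for which the interior of `R_l` intersects
`{y ∈ Ω : |y - z_k|_∞ < w}`. -/
def neighbours (w : ℝ) (n : ℕ) (k : Fin n × Fin n) : Finset (Fin n × Fin n) :=
  Finset.univ.filter fun l => (cell n l ∩ {y | y ∈ unitSquare ∧ ‖y - node n k‖ < w}).Nonempty

/-- `w_h = (⌈w/h - 1/2⌉ + 1/2) h`. -/
def discreteWidth (w : ℝ) (n : ℕ) : ℝ :=
  ((⌈w / gridSize n - 1 / 2⌉ : ℝ) + 1 / 2) * gridSize n

/-- The midpoint cubature weights `γ_{kl} = h² (2 α_{w_h} π)⁻¹ G_σ(z_k - z_l)`. -/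
def weight (σ w : ℝ) (n : ℕ) (k l : Fin n × Fin n) : ℝ :=
  gridSize n ^ 2 * (2 * alpha σ (discreteWidth w n) * Real.pi)⁻¹ * gauss σ (node n k - node n l)

/-- The condition on the renormalization parameter `η`: `(1 + η) ∑_{l ∈ N_k} γ_{kl} = 1` for all
`k` such that the square `{y ∈ ℝ² : |y - z_k|_∞ < w_h}` is contained in `Ω`. -/
def IsRenormalization (σ w : ℝ) (n : ℕ) (η : ℝ) : Prop :=
  ∀ k : Fin n × Fin n, {y : ℝ × ℝ | ‖y - node n k‖ < discreteWidth w n} ⊆ unitSquare →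
    (1 + η) * ∑ l ∈ neighbours w n k, weight σ w n k l = 1

/-- The nodal values `k ↦ (1 + η) ∑_{l ∈ N_k} γ_{kl} u(z_l)` of the discrete blurring of `u`. -/
def nodalBlur (σ w : ℝ) (n : ℕ) (η : ℝ) : (ℝ × ℝ → ℝ) →ₗ[ℝ] (Fin n × Fin n → ℝ) where
  toFun u k := (1 + η) * ∑ l ∈ neighbours w n k, weight σ w n k l * u (node n l)
  map_add' u v := by
    funext k
    simp only [Pi.add_apply, mul_add, Finset.sum_add_distrib]
  map_smul' a u := by
    funext k
    simp only [Pi.smul_apply, smul_eq_mul, RingHom.id_apply, Finset.mul_sum]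
    exact Finset.sum_congr rfl fun l _ => by ring

/-- The discrete operator `K_h` on `U_h`: `K_h u` is the piecewise constant function with
`(K_h u)(z_k) = (1 + η) ∑_{l ∈ N_k} γ_{kl} u(z_l)`. -/
def discreteBlur (σ w : ℝ) (n : ℕ) (η : ℝ) : piecewiseConstant n →ₗ[ℝ] piecewiseConstant n :=
  (stepFunction n).rangeRestrict ∘ₗ nodalBlur σ w n η ∘ₗ (piecewiseConstant n).subtype

/-- Part [b] of the smoothed approximation condition with constant `C`: an operator `K` and
discretizations `K_j` on spaces `U_j` with mesh sizes `h_j` satisfy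
`‖K u - K_j u‖_{L²(Ω)} ≤ C h_j ‖u‖_{L²(Ω)}` for all `j` and all `u ∈ U_j`. -/
def SmoothedApproximation (K : (ℝ × ℝ → ℝ) → (ℝ × ℝ → ℝ)) (U : ℕ → Submodule ℝ (ℝ × ℝ → ℝ))
    (Kd : ∀ j, U j →ₗ[ℝ] U j) (h : ℕ → ℝ) (C : ℝ) : Prop :=
  ∀ (j : ℕ) (u : U j),
    eLpNorm (K (u : ℝ × ℝ → ℝ) - (Kd j u : ℝ × ℝ → ℝ)) 2 areaΩ ≤
      ENNReal.ofReal (C * h j) * eLpNorm (u : ℝ × ℝ → ℝ) 2 areaΩ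

/-- Part [c] of the smoothed approximation condition with constant `C`:
`‖K_j u‖_{L^∞(Ω)} ≤ C ‖u‖_{L²(Ω)}` for all `j` and all `u ∈ U_j`. -/
def L2LinftyStability (U : ℕ → Submodule ℝ (ℝ × ℝ → ℝ)) (Kd : ∀ j, U j →ₗ[ℝ] U j)
    (C : ℝ) : Prop :=
  ∀ (j : ℕ) (u : U j),
    eLpNorm (Kd j u : ℝ × ℝ → ℝ) ∞ areaΩ ≤
      ENNReal.ofReal C * eLpNorm (u : ℝ × ℝ → ℝ) 2 areaΩ

end GaussianBlur

end

/-!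
Both operators have, up to normalization, the same convolution kernel: `G_σ` cut off at a square,
of half-width `w` for `K^{σ,w}` and `w + h / 2` for `K_h`, where the latter kernel is sampled at
the nodes. On a pair of cells the two kernels differ by `O(h)`, except where `|x - y|_∞` is within
`O(h)` of `w`; there they differ by `O(1)`, but for fixed `x` or fixed `y` this is a shell of area
`O(h)`. Hence all row and column integrals of the difference are `O(h)`, and the Schur test bounds
its `L²` operator norm.

The normalizations fit into the same picture. The factor `α_{w_h}` cancels against `1 + η`, so that
`K_h` is normalized by its own row sum at an interior node. By translation invariance this row sum
is the same at all of them, and since `w ≤ w_h`, it differs from the mass of `G_σ` on the square of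
half-width `w` by a row integral of the kernel difference, hence by `O(h)`.
-/

open scoped NNReal

section SchurTest

variable {α β E F : Type*} [MeasurableSpace α] [MeasurableSpace β] [ENorm E]
  [NormedAddCommGroup F] {μ : Measure α} {ν : Measure β}

theorem lintegral_mul_rpow_le {p : ℝ} (hp : 1 ≤ p) {κ f : β → ℝ≥0∞} (hκ : AEMeasurable κ ν)
    (hf : AEMeasurable f ν) :
    (∫⁻ y, κ y * f y ∂ν) ^ p ≤ (∫⁻ y, κ y ∂ν) ^ (p - 1) * ∫⁻ y, κ y * f y ^ p ∂ν := by
  have hp₀ : 0 < p := by linarith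
  have hp₁ : p⁻¹ ≤ 1 := inv_le_one_of_one_le₀ hp
  have split (s t : ℝ≥0∞) : s ^ (1 - p⁻¹) * (s * t ^ p) ^ p⁻¹ = s * t := by
    rw [ENNReal.mul_rpow_of_nonneg _ _ (inv_nonneg.2 hp₀.le), ENNReal.rpow_rpow_inv hp₀.ne',
      ← mul_assoc, ← ENNReal.rpow_add_of_nonneg _ _ (sub_nonneg.2 hp₁) (inv_nonneg.2 hp₀.le),
      sub_add_cancel, ENNReal.rpow_one]
  have hoelder := ENNReal.lintegral_mul_norm_pow_le hκ (hκ.mul (hf.pow_const p))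
    (sub_nonneg.2 hp₁) (inv_nonneg.2 hp₀.le) (sub_add_cancel 1 p⁻¹)
  simp only [Pi.mul_apply, split] at hoelder
  calc (∫⁻ y, κ y * f y ∂ν) ^ p
      ≤ ((∫⁻ y, κ y ∂ν) ^ (1 - p⁻¹) * (∫⁻ y, κ y * f y ^ p ∂ν) ^ p⁻¹) ^ p := by gcongr
    _ = (∫⁻ y, κ y ∂ν) ^ (p - 1) * ∫⁻ y, κ y * f y ^ p ∂ν := by
      rw [ENNReal.mul_rpow_of_nonneg _ _ hp₀.le, ENNReal.rpow_inv_rpow hp₀.ne',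
        ← ENNReal.rpow_mul, sub_mul, one_mul, inv_mul_cancel₀ hp₀.ne']

/-- The **Schur test**. -/
theorem eLpNorm_le_of_enorm_le_lintegral_mul [SFinite μ] [SFinite ν] {p : ℝ≥0} (hp : 1 ≤ p)
    {κ : α → β → ℝ≥0∞} (hκ : Measurable (Function.uncurry κ)) {a b : ℝ≥0∞}
    (hrow : ∀ x, ∫⁻ y, κ x y ∂ν ≤ a) (hcol : ∀ y, ∫⁻ x, κ x y ∂μ ≤ b)
    {u : β → F} (hu : AEStronglyMeasurable u ν) {v : α → E}
    (hv : ∀ᵐ x ∂μ, ‖v x‖ₑ ≤ ∫⁻ y, κ x y * ‖u y‖ₑ ∂ν) :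
    eLpNorm v p μ ≤ a ^ (1 - (p : ℝ)⁻¹) * b ^ (p : ℝ)⁻¹ * eLpNorm u p ν := by
  have hp₁ : (1 : ℝ) ≤ p := hp
  have hp₀ : (0 : ℝ) < p := by linarith
  have hp' : p ≠ 0 := by exact_mod_cast hp₀.ne'
  have hm : AEMeasurable (Function.uncurry fun x y => κ x y * ‖u y‖ₑ ^ (p : ℝ)) (μ.prod ν) :=
    hκ.aemeasurable.mul (hu.enorm.comp_snd.pow_const _)
  rw [← ENNReal.rpow_le_rpow_iff hp₀, ENNReal.mul_rpow_of_nonneg _ _ hp₀.le,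
    eLpNorm_nnreal_pow_eq_lintegral hp', eLpNorm_nnreal_pow_eq_lintegral hp']
  calc ∫⁻ x, ‖v x‖ₑ ^ (p : ℝ) ∂μ
      ≤ ∫⁻ x, a ^ ((p : ℝ) - 1) * ∫⁻ y, κ x y * ‖u y‖ₑ ^ (p : ℝ) ∂ν ∂μ := by
        refine lintegral_mono_ae (hv.mono fun x hx => ?_)
        refine (ENNReal.rpow_le_rpow hx hp₀.le).trans <|
          (lintegral_mul_rpow_le hp₁ hκ.of_uncurry_left.aemeasurable hu.enorm).trans ?_
        gcongr
        exact hrow x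
    _ = a ^ ((p : ℝ) - 1) * ∫⁻ y, ∫⁻ x, κ x y * ‖u y‖ₑ ^ (p : ℝ) ∂μ ∂ν := by
        rw [lintegral_const_mul'' _ hm.lintegral_prod_right, lintegral_lintegral_swap hm]
    _ ≤ a ^ ((p : ℝ) - 1) * ∫⁻ y, b * ‖u y‖ₑ ^ (p : ℝ) ∂ν := by
        gcongr with y
        rw [lintegral_mul_const _ hκ.of_uncurry_right]
        gcongr
        exact hcol y
    _ = (a ^ (1 - (p : ℝ)⁻¹) * b ^ (p : ℝ)⁻¹) ^ (p : ℝ) * ∫⁻ y, ‖u y‖ₑ ^ (p : ℝ) ∂ν := by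
        rw [lintegral_const_mul'' _ (hu.enorm.pow_const _),
          ENNReal.mul_rpow_of_nonneg _ _ hp₀.le, ENNReal.rpow_inv_rpow hp₀.ne',
          ← ENNReal.rpow_mul, sub_mul, one_mul, inv_mul_cancel₀ hp₀.ne', mul_assoc]

end SchurTest

theorem abs_sq_sub_sq_le {a b R d : ℝ} (ha : |a| ≤ R) (hb : |b| ≤ R) (hab : |a - b| ≤ d) :
    |a ^ 2 - b ^ 2| ≤ 2 * R * d := by
  rw [sq_sub_sq, abs_mul]
  exact mul_le_mul ((abs_add_le a b).trans (by linarith)) hab (abs_nonneg _)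
    (by linarith [abs_nonneg a])

theorem lipschitzOnWith_exp_Iic_zero : LipschitzOnWith 1 Real.exp (Set.Iic 0) :=
  (convex_Iic 0).lipschitzOnWith_of_nnnorm_deriv_le (fun _ _ => Real.differentiableAt_exp)
    fun x hx => by simpa [← NNReal.coe_le_coe] using hx

section Plane

theorem volume_ball_prod (x : ℝ × ℝ) {r : ℝ} (hr : 0 ≤ r) :
    volume (Metric.ball x r) = ENNReal.ofReal (4 * r ^ 2) := by
  rw [← ball_prod_same, Measure.volume_eq_prod, Measure.prod_prod, Real.volume_ball,
    Real.volume_ball, ← ENNReal.ofReal_mul (by positivity)]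
  ring_nf

theorem volume_closedBall_prod (x : ℝ × ℝ) {r : ℝ} (hr : 0 ≤ r) :
    volume (Metric.closedBall x r) = ENNReal.ofReal (4 * r ^ 2) := by
  rw [← closedBall_prod_same, Measure.volume_eq_prod, Measure.prod_prod, Real.volume_closedBall,
    Real.volume_closedBall, ← ENNReal.ofReal_mul (by positivity)]
  ring_nf

theorem volume_setOf_abs_norm_sub_le (x : ℝ × ℝ) {w δ : ℝ} (hδ : 0 ≤ δ) (hδw : δ ≤ w) :
    volume {y | |‖x - y‖ - w| ≤ δ} = ENNReal.ofReal (16 * w * δ) := by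
  have hset : {y | |‖x - y‖ - w| ≤ δ} =
      Metric.closedBall x (w + δ) \ Metric.ball x (w - δ) := by
    ext y
    rw [Set.mem_ofPred_eq, Set.mem_sdiff, mem_closedBall_iff_norm', mem_ball_iff_norm', abs_le,
      not_lt]
    constructor <;> rintro ⟨h₁, h₂⟩ <;> constructor <;> linarith
  have hsub : Metric.ball x (w - δ) ⊆ Metric.closedBall x (w + δ) :=
    Metric.ball_subset_closedBall.trans (Metric.closedBall_subset_closedBall (by linarith))
  rw [hset, measure_sdiff hsub measurableSet_ball.nullMeasurableSet measure_ball_lt_top.ne,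
    volume_closedBall_prod x (by linarith), volume_ball_prod x (by linarith),
    ← ENNReal.ofReal_sub _ (by positivity)]
  ring_nf

end Plane

noncomputable section

namespace GaussianBlur

variable {σ w h : ℝ} {n : ℕ} {k l : Fin n × Fin n} {x y z z' : ℝ × ℝ}

section Gaussian

theorem gauss_pos (hσ : σ ≠ 0) (z : ℝ × ℝ) : 0 < gauss σ z := by unfold gauss; positivity

theorem gauss_exponent_nonpos (σ : ℝ) (z : ℝ × ℝ) : -(z.1 ^ 2 + z.2 ^ 2) / (2 * σ ^ 2) ≤ 0 :=
  div_nonpos_of_nonpos_of_nonneg (neg_nonpos.2 (by positivity)) (by positivity)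

theorem gauss_mem_Icc (σ : ℝ) (z : ℝ × ℝ) : gauss σ z ∈ Set.Icc 0 (σ ^ 2)⁻¹ :=
  ⟨by unfold gauss; positivity,
    mul_le_of_le_one_right (by positivity) (Real.exp_le_one_iff.2 (gauss_exponent_nonpos σ z))⟩

theorem continuous_gauss (σ : ℝ) : Continuous (gauss σ) := by unfold gauss; fun_prop

theorem abs_gauss_sub_gauss_le (σ : ℝ) {R : ℝ} (hz : ‖z‖ ≤ R) (hz' : ‖z'‖ ≤ R) :
    |gauss σ z - gauss σ z'| ≤ 2 * R / σ ^ 4 * ‖z - z'‖ := by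
  have hfst := abs_sq_sub_sq_le ((norm_fst_le z).trans hz) ((norm_fst_le z').trans hz')
    (norm_fst_le (z - z'))
  have hsnd := abs_sq_sub_sq_le ((norm_snd_le z).trans hz) ((norm_snd_le z').trans hz')
    (norm_snd_le (z - z'))
  calc |gauss σ z - gauss σ z'|
      = (σ ^ 2)⁻¹ * |Real.exp (-(z.1 ^ 2 + z.2 ^ 2) / (2 * σ ^ 2)) -
          Real.exp (-(z'.1 ^ 2 + z'.2 ^ 2) / (2 * σ ^ 2))| := by
        rw [gauss, gauss, ← mul_sub, abs_mul, abs_of_nonneg (by positivity : 0 ≤ (σ ^ 2)⁻¹)]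
    _ ≤ (σ ^ 2)⁻¹ * |-(z.1 ^ 2 + z.2 ^ 2) / (2 * σ ^ 2) -
          -(z'.1 ^ 2 + z'.2 ^ 2) / (2 * σ ^ 2)| := by
        refine mul_le_mul_of_nonneg_left ?_ (by positivity)
        simpa only [Real.dist_eq, NNReal.coe_one, one_mul] using
          lipschitzOnWith_exp_Iic_zero.dist_le_mul _ (gauss_exponent_nonpos σ z) _
            (gauss_exponent_nonpos σ z')
    _ = (σ ^ 2)⁻¹ * (|(z'.1 ^ 2 - z.1 ^ 2) + (z'.2 ^ 2 - z.2 ^ 2)| / (2 * σ ^ 2)) := by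
        rw [← sub_div, abs_div, abs_of_nonneg (by positivity : 0 ≤ 2 * σ ^ 2)]
        ring_nf
    _ ≤ (σ ^ 2)⁻¹ * ((2 * R * ‖z - z'‖ + 2 * R * ‖z - z'‖) / (2 * σ ^ 2)) := by
        gcongr
        refine (abs_add_le _ _).trans (add_le_add ?_ ?_) <;> rw [abs_sub_comm]
        exacts [hfst, hsnd]
    _ = 2 * R / σ ^ 4 * ‖z - z'‖ := by ring

/-- The convolution kernel `G_σ 1_{|z|_∞ < w}` shared by both operators: `K^{σ,w}` uses it at
`z = x - y`, and `K_h` uses it, with the width `w + h / 2`, at `z = z_k - z_l`. -/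
def cutoffGauss (σ w : ℝ) : ℝ × ℝ → ℝ := (Metric.ball 0 w).indicator (gauss σ)

theorem cutoffGauss_of_norm_lt (hz : ‖z‖ < w) : cutoffGauss σ w z = gauss σ z :=
  Set.indicator_of_mem (mem_ball_zero_iff.2 hz) _

theorem cutoffGauss_of_le_norm (hz : w ≤ ‖z‖) : cutoffGauss σ w z = 0 :=
  Set.indicator_of_notMem (mt mem_ball_zero_iff.1 hz.not_gt) _

theorem measurable_cutoffGauss (σ w : ℝ) : Measurable (cutoffGauss σ w) :=
  (continuous_gauss σ).measurable.indicator measurableSet_ball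

theorem cutoffGauss_mem_Icc (σ w : ℝ) (z : ℝ × ℝ) : cutoffGauss σ w z ∈ Set.Icc 0 (σ ^ 2)⁻¹ := by
  by_cases hz : ‖z‖ < w
  · rw [cutoffGauss_of_norm_lt hz]
    exact gauss_mem_Icc σ z
  · rw [cutoffGauss_of_le_norm (not_lt.1 hz)]
    exact ⟨le_rfl, by positivity⟩

/-- The mass `2π α_w` of the kernel of the blurring operator, before normalization. -/
def gaussMass (σ w : ℝ) : ℝ := ∫ z, cutoffGauss σ w z

theorem gaussMass_pos (hσ : σ ≠ 0) (hw : 0 < w) : 0 < gaussMass σ w := by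
  have hsupport : Function.support (gauss σ) = Set.univ :=
    Set.eq_univ_of_forall fun z => (gauss_pos hσ z).ne'
  rw [gaussMass, cutoffGauss, integral_indicator measurableSet_ball,
    setIntegral_pos_iff_support_of_nonneg_ae (ae_of_all _ fun z => (gauss_mem_Icc σ z).1)]
  · rw [hsupport, Set.univ_inter]
    exact Metric.measure_ball_pos _ _ hw
  · exact (continuous_gauss σ).continuousOn.integrableOn_compact (isCompact_closedBall 0 w)
      |>.mono_set Metric.ball_subset_closedBall

theorem alpha_eq (σ w : ℝ) : alpha σ w = (2 * Real.pi)⁻¹ * gaussMass σ w := by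
  rw [alpha, gaussMass, cutoffGauss, integral_indicator measurableSet_ball, ball_zero_eq]

end Gaussian

section UnitSquare

theorem measurableSet_unitSquare : MeasurableSet unitSquare :=
  measurableSet_Ioo.prod measurableSet_Ioo

theorem volume_unitSquare : volume unitSquare = 1 := by
  simp [unitSquare, Measure.volume_eq_prod, Measure.prod_prod]

instance : IsProbabilityMeasure areaΩ :=
  ⟨by rw [areaΩ, Measure.restrict_apply_univ, volume_unitSquare]⟩

theorem memLp_cutoffGauss_sub (σ w : ℝ) (x : ℝ × ℝ) (p : ℝ≥0∞) :
    MemLp (fun y => cutoffGauss σ w (x - y)) p areaΩ :=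
  .of_bound ((measurable_cutoffGauss σ w).comp (by fun_prop)).aestronglyMeasurable (σ ^ 2)⁻¹ <|
    ae_of_all _ fun y => by
      rw [Real.norm_of_nonneg (cutoffGauss_mem_Icc σ w _).1]
      exact (cutoffGauss_mem_Icc σ w _).2

theorem integral_cutoffGauss_sub (σ : ℝ) (hx : Metric.ball x w ⊆ unitSquare) :
    ∫ y, cutoffGauss σ w (x - y) ∂areaΩ = gaussMass σ w := by
  rw [areaΩ, setIntegral_eq_integral_of_forall_compl_eq_zero, gaussMass,
    integral_sub_left_eq_self (cutoffGauss σ w)]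
  exact fun y hy => cutoffGauss_of_le_norm <| not_lt.1 fun h => hy (hx (mem_ball_iff_norm'.2 h))

theorem blur_eq_integral (σ w : ℝ) (u : ℝ × ℝ → ℝ) (x : ℝ × ℝ) :
    blur σ w u x = (gaussMass σ w)⁻¹ * ∫ y, cutoffGauss σ w (x - y) * u y ∂areaΩ := by
  have hmeas : MeasurableSet {y : ℝ × ℝ | ‖x - y‖ < w} :=
    measurableSet_lt (by fun_prop) measurable_const
  have hscale : (alpha σ w)⁻¹ * (2 * Real.pi)⁻¹ = (gaussMass σ w)⁻¹ := by
    rw [alpha_eq, mul_inv_rev, inv_inv, mul_inv_cancel_right₀ (by positivity)]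
  rw [blur, hscale, areaΩ, ← integral_indicator hmeas,
    ← integral_indicator measurableSet_unitSquare]
  congr 2 with y
  by_cases hyΩ : y ∈ unitSquare <;> by_cases hy : ‖x - y‖ < w <;>
    simp only [cutoffGauss, Set.indicator, mem_ball_zero_iff, Set.mem_ofPred_eq, hyΩ, hy, if_true,
      if_false, mul_zero, zero_mul]

end UnitSquare

section KernelError

/-- A common bound of the difference of the kernels of `K^{σ,w}` and `K_h`, before normalization,
at points `x` and `y` of the cells `R_k` and `R_l` with `z = x - y`. The first term accounts for the
variation of `G_σ` over the cells, the second one for the different shapes of the cutoffs, which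
matter only close to `|z|_∞ = w`. -/
def kernelError (σ w h : ℝ) (z : ℝ × ℝ) : ℝ≥0∞ :=
  ENNReal.ofReal (4 * w / σ ^ 4 * h) +
    {z : ℝ × ℝ | |‖z‖ - w| ≤ 2 * h}.indicator (fun _ => ENNReal.ofReal (σ ^ 2)⁻¹) z

theorem kernelError_neg (σ w h : ℝ) (z : ℝ × ℝ) :
    kernelError σ w h (-z) = kernelError σ w h z := by
  simp only [kernelError, Set.indicator, Set.mem_ofPred_eq, norm_neg]

theorem measurableSet_setOf_abs_norm_sub_le (w δ : ℝ) :
    MeasurableSet {z : ℝ × ℝ | |‖z‖ - w| ≤ δ} :=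
  measurableSet_le (by fun_prop) measurable_const

theorem measurable_kernelError (σ w h : ℝ) : Measurable (kernelError σ w h) :=
  (measurable_const.indicator (measurableSet_setOf_abs_norm_sub_le w (2 * h))).const_add _

theorem enorm_cutoffGauss_sub_cutoffGauss_le (σ : ℝ) (hhw : h ≤ 2 * w) (hzz' : ‖z - z'‖ ≤ h) :
    ‖cutoffGauss σ w z - cutoffGauss σ (w + h / 2) z'‖ₑ ≤ kernelError σ w h z := by
  have hh : 0 ≤ h := (norm_nonneg _).trans hzz'
  have hnorm := abs_le.1 ((abs_norm_sub_norm_le z z').trans hzz')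
  rw [Real.enorm_eq_ofReal_abs, kernelError]
  by_cases hshell : |‖z‖ - w| ≤ 2 * h
  · rw [Set.indicator_of_mem (by exact hshell)]
    refine le_add_left (ENNReal.ofReal_le_ofReal ?_)
    obtain ⟨h₀, h₁⟩ := cutoffGauss_mem_Icc σ w z
    obtain ⟨h₀', h₁'⟩ := cutoffGauss_mem_Icc σ (w + h / 2) z'
    exact abs_sub_le_of_nonneg_of_le h₀ h₁ h₀' h₁'
  refine le_add_right (ENNReal.ofReal_le_ofReal ?_)
  rcases lt_abs.1 (not_le.1 hshell) with houter | hinner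
  · rw [cutoffGauss_of_le_norm (by linarith), cutoffGauss_of_le_norm (by linarith), sub_zero,
      abs_zero]
    have : 0 ≤ w := by linarith
    positivity
  · have hz : ‖z‖ < w := by linarith
    have hz' : ‖z'‖ < w + h / 2 := by linarith
    rw [cutoffGauss_of_norm_lt hz, cutoffGauss_of_norm_lt hz']
    calc |gauss σ z - gauss σ z'|
        ≤ 2 * (2 * w) / σ ^ 4 * ‖z - z'‖ :=
          abs_gauss_sub_gauss_le σ (by linarith [norm_nonneg z]) (by linarith)
      _ ≤ 4 * w / σ ^ 4 * h := by
          have : 0 ≤ w := by linarith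
          rw [← mul_assoc]
          norm_num1
          gcongr

/-- The factor of `h` in the integral of `kernelError`. -/
def kernelErrorConst (σ w : ℝ) : ℝ := 4 * w / σ ^ 4 + 32 * w * (σ ^ 2)⁻¹

theorem lintegral_kernelError_sub_le (σ : ℝ) (hh : 0 ≤ h) (hhw : 2 * h ≤ w) (x : ℝ × ℝ) :
    ∫⁻ y, kernelError σ w h (x - y) ∂areaΩ ≤ ENNReal.ofReal (kernelErrorConst σ w * h) := by
  have hw₀ : 0 ≤ w := by linarith
  calc ∫⁻ y, kernelError σ w h (x - y) ∂areaΩ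
      = ENNReal.ofReal (4 * w / σ ^ 4 * h) +
          ENNReal.ofReal (σ ^ 2)⁻¹ * areaΩ {y | |‖x - y‖ - w| ≤ 2 * h} := by
        have hmeas : MeasurableSet {y : ℝ × ℝ | |‖x - y‖ - w| ≤ 2 * h} :=
          (measurableSet_setOf_abs_norm_sub_le w (2 * h)).preimage (measurable_const_sub x)
        rw [← lintegral_indicator_const hmeas]
        simp only [kernelError]
        rw [lintegral_add_left measurable_const, lintegral_const, measure_univ, mul_one]
        rfl
    _ ≤ ENNReal.ofReal (4 * w / σ ^ 4 * h) +
          ENNReal.ofReal (σ ^ 2)⁻¹ * ENNReal.ofReal (16 * w * (2 * h)) := by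
        gcongr
        exact (Measure.restrict_apply_le _ _).trans
          (volume_setOf_abs_norm_sub_le x (by positivity) hhw).le
    _ = ENNReal.ofReal (kernelErrorConst σ w * h) := by
        rw [← ENNReal.ofReal_mul (by positivity), ← ENNReal.ofReal_add (by positivity)
          (by positivity), kernelErrorConst]
        ring_nf

end KernelError

section Grid

theorem gridSize_nonneg (n : ℕ) : 0 ≤ gridSize n := by unfold gridSize; positivity

theorem gridSize_pos (hn : 0 < n) : 0 < gridSize n := by unfold gridSize; positivity

theorem natCast_mul_gridSize (hn : 0 < n) : n * gridSize n = 1 := by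
  unfold gridSize; field_simp

theorem cell_eq_ball (n : ℕ) (k : Fin n × Fin n) :
    cell n k = Metric.ball (node n k) (gridSize n / 2) := by
  rw [cell, node, ← ball_prod_same, Real.ball_eq_Ioo, Real.ball_eq_Ioo]
  ring_nf

theorem measurableSet_cell (n : ℕ) (k : Fin n × Fin n) : MeasurableSet (cell n k) :=
  measurableSet_Ioo.prod measurableSet_Ioo

theorem volume_cell (n : ℕ) (k : Fin n × Fin n) :
    volume (cell n k) = ENNReal.ofReal (gridSize n ^ 2) := by
  rw [cell_eq_ball, volume_ball_prod _ (by linarith [gridSize_nonneg n])]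
  ring_nf

theorem cell_subset_unitSquare (n : ℕ) (k : Fin n × Fin n) : cell n k ⊆ unitSquare := by
  have hh := gridSize_nonneg n
  have hside (i : Fin n) : Set.Ioo (i * gridSize n) ((i + 1) * gridSize n) ⊆ Set.Ioo 0 1 := by
    have hi : (i : ℝ) + 1 ≤ n := by exact_mod_cast i.isLt
    refine Set.Ioo_subset_Ioo (by positivity) ?_
    calc (i + 1) * gridSize n ≤ n * gridSize n := by gcongr
      _ = 1 := natCast_mul_gridSize i.pos
  exact Set.prod_mono (hside k.1) (hside k.2)

theorem node_mem_cell (n : ℕ) (k : Fin n × Fin n) : node n k ∈ cell n k := by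
  rw [cell_eq_ball]
  exact Metric.mem_ball_self (half_pos (gridSize_pos k.1.pos))

theorem eq_of_mem_cell (hk : x ∈ cell n k) (hl : x ∈ cell n l) : k = l := by
  have key {i j : Fin n} {t : ℝ} (hi : t ∈ Set.Ioo (i * gridSize n) ((i + 1) * gridSize n))
      (hj : t ∈ Set.Ioo (j * gridSize n) ((j + 1) * gridSize n)) : i ≤ j := by
    have hlt : (i : ℝ) < j + 1 := lt_of_mul_lt_mul_right (hi.1.trans hj.2) (gridSize_nonneg n)
    exact Fin.le_def.2 (Nat.lt_succ_iff.1 (by exact_mod_cast hlt))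
  exact Prod.ext ((key hk.1 hl.1).antisymm (key hl.1 hk.1))
    ((key hk.2 hl.2).antisymm (key hl.2 hk.2))

theorem ae_mem_cell (hn : 0 < n) : ∀ᵐ x ∂areaΩ, ∃ k, x ∈ cell n k := by
  have hdisj : Pairwise (Function.onFun Disjoint (cell n)) := fun k l hkl =>
    Set.disjoint_left.2 fun x hk hl => hkl (eq_of_mem_cell hk hl)
  have hcover : areaΩ (⋃ k, cell n k) = 1 := by
    rw [areaΩ, Measure.restrict_eq_self _ (Set.iUnion_subset (cell_subset_unitSquare n)),
      measure_iUnion hdisj (measurableSet_cell n), tsum_fintype]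
    simp only [volume_cell, Finset.sum_const, Finset.card_univ, Fintype.card_prod,
      Fintype.card_fin, nsmul_eq_mul]
    rw [← ENNReal.ofReal_natCast, ← ENNReal.ofReal_mul (by positivity), Nat.cast_mul,
      show (n * n : ℝ) * gridSize n ^ 2 = (n * gridSize n) ^ 2 by ring,
      natCast_mul_gridSize hn, one_pow, ENNReal.ofReal_one]
  have hae := (prob_compl_eq_zero_iff (.iUnion (measurableSet_cell n))).2 hcover
  filter_upwards [measure_eq_zero_iff_ae_notMem.1 hae] with x hx
  exact Set.mem_iUnion.1 (not_not.1 hx)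

theorem stepFunction_of_mem (d : Fin n × Fin n → ℝ) (hx : x ∈ cell n k) :
    stepFunction n d x = d k :=
  (Finset.sum_eq_single k (fun _ _ hl => Set.indicator_of_notMem
    (fun hxl => hl (eq_of_mem_cell hxl hx)) _) (by simp)).trans (Set.indicator_of_mem hx _)

theorem apply_eq_apply_node (u : piecewiseConstant n) (hx : x ∈ cell n k) :
    (u : ℝ × ℝ → ℝ) x = (u : ℝ × ℝ → ℝ) (node n k) := by
  obtain ⟨_, d, rfl⟩ := u
  exact (stepFunction_of_mem d hx).trans (stepFunction_of_mem d (node_mem_cell n k)).symm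

theorem memLp_stepFunction (d : Fin n × Fin n → ℝ) (p : ℝ≥0∞) :
    MemLp (stepFunction n d) p areaΩ :=
  memLp_finsetSum _ fun k _ => (memLp_const (d k)).indicator (measurableSet_cell n k)

theorem memLp_piecewiseConstant (u : piecewiseConstant n) (p : ℝ≥0∞) :
    MemLp (u : ℝ × ℝ → ℝ) p areaΩ := by
  obtain ⟨_, d, rfl⟩ := u
  exact memLp_stepFunction d p

theorem integral_stepFunction (d : Fin n × Fin n → ℝ) :
    ∫ x, stepFunction n d x ∂areaΩ = gridSize n ^ 2 * ∑ k, d k := by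
  have hcell (k : Fin n × Fin n) : areaΩ.real (cell n k) = gridSize n ^ 2 := by
    rw [Measure.real, areaΩ, Measure.restrict_eq_self _ (cell_subset_unitSquare n k), volume_cell,
      ENNReal.toReal_ofReal (by positivity)]
  calc ∫ x, stepFunction n d x ∂areaΩ
      = ∑ k, ∫ x, (cell n k).indicator (fun _ => d k) x ∂areaΩ :=
        integral_finsetSum _ fun k _ => (integrable_const (d k)).indicator (measurableSet_cell n k)
    _ = gridSize n ^ 2 * ∑ k, d k := by
        simp only [integral_indicator_const _ (measurableSet_cell n _), hcell, smul_eq_mul,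
          Finset.mul_sum]

theorem integral_stepFunction_mul (hn : 0 < n) (d : Fin n × Fin n → ℝ)
    (u : piecewiseConstant n) :
    ∫ y, stepFunction n d y * (u : ℝ × ℝ → ℝ) y ∂areaΩ =
      gridSize n ^ 2 * ∑ l, d l * (u : ℝ × ℝ → ℝ) (node n l) := by
  rw [← integral_stepFunction]
  refine integral_congr_ae ((ae_mem_cell hn).mono ?_)
  rintro y ⟨l, hy⟩
  simp only [stepFunction_of_mem _ hy, apply_eq_apply_node u hy]

end Grid

section DiscreteKernel

/-- The kernel of `K_h`, before normalization, at the nodes `z_k` and `z_l`. The index set `N_k` is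
encoded by the width `w + h / 2` of the cutoff, see `mem_neighbours_iff`. -/
def discreteKernel (σ w : ℝ) (n : ℕ) (k l : Fin n × Fin n) : ℝ :=
  cutoffGauss σ (w + gridSize n / 2) (node n k - node n l)

theorem mem_neighbours_iff (hw : 0 < w) :
    l ∈ neighbours w n k ↔ ‖node n k - node n l‖ < w + gridSize n / 2 := by
  have hh := half_pos (gridSize_pos k.1.pos)
  have hset : cell n l ∩ {y | y ∈ unitSquare ∧ ‖y - node n k‖ < w} =
      Metric.ball (node n k) w ∩ Metric.ball (node n l) (gridSize n / 2) := by
    rw [← cell_eq_ball]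
    ext y
    simp only [Set.mem_inter_iff, Set.mem_ofPred_eq, mem_ball_iff_norm]
    exact ⟨fun ⟨hl, _, hk⟩ => ⟨hk, hl⟩, fun ⟨hk, hl⟩ => ⟨hl, cell_subset_unitSquare n l hl, hk⟩⟩
  simp only [neighbours, Finset.mem_filter, Finset.mem_univ, true_and]
  rw [hset, ← Set.not_disjoint_iff_nonempty_inter,
    disjoint_ball_ball_iff hw hh, not_le, dist_eq_norm]

theorem enorm_cutoffGauss_sub_discreteKernel_le (σ : ℝ) (hhw : gridSize n ≤ 2 * w)
    (hx : x ∈ cell n k) (hy : y ∈ cell n l) :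
    ‖cutoffGauss σ w (x - y) - discreteKernel σ w n k l‖ₑ ≤
      kernelError σ w (gridSize n) (x - y) := by
  refine enorm_cutoffGauss_sub_cutoffGauss_le σ hhw ?_
  rw [cell_eq_ball, mem_ball_iff_norm] at hx hy
  calc ‖x - y - (node n k - node n l)‖ = ‖x - node n k - (y - node n l)‖ := by
        rw [sub_sub_sub_comm]
    _ ≤ ‖x - node n k‖ + ‖y - node n l‖ := norm_sub_le _ _
    _ ≤ gridSize n := by linarith

theorem weight_eq (σ w : ℝ) (n : ℕ) (k l : Fin n × Fin n) :
    weight σ w n k l =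
      gridSize n ^ 2 * (gaussMass σ (discreteWidth w n))⁻¹ * gauss σ (node n k - node n l) := by
  rw [weight, alpha_eq]
  field_simp

theorem sum_neighbours_weight_mul (σ : ℝ) (hw : 0 < w) (k : Fin n × Fin n)
    (c : Fin n × Fin n → ℝ) :
    ∑ l ∈ neighbours w n k, weight σ w n k l * c l =
      (gaussMass σ (discreteWidth w n))⁻¹ *
        (gridSize n ^ 2 * ∑ l, discreteKernel σ w n k l * c l) := by
  have hvanish : ∀ l ∉ neighbours w n k, discreteKernel σ w n k l * c l = 0 := fun l hl => by
    rw [mem_neighbours_iff hw, not_lt] at hl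
    rw [discreteKernel, cutoffGauss_of_le_norm hl, zero_mul]
  rw [← Finset.sum_subset (Finset.subset_univ (neighbours w n k)) fun l _ => hvanish l,
    Finset.mul_sum, Finset.mul_sum]
  refine Finset.sum_congr rfl fun l hl => ?_
  rw [weight_eq, discreteKernel, cutoffGauss_of_norm_lt ((mem_neighbours_iff hw).1 hl)]
  ring

end DiscreteKernel

section Renormalization

/-- The condition on a node `z_k` at which the renormalization parameter is prescribed. -/
def IsInterior (w : ℝ) (n : ℕ) (k : Fin n × Fin n) : Prop :=
  Metric.ball (node n k) (discreteWidth w n) ⊆ unitSquare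

theorem le_discreteWidth (w : ℝ) (hn : 0 < n) : w ≤ discreteWidth w n := by
  rw [discreteWidth, ← div_le_iff₀ (gridSize_pos hn)]
  linarith [Int.le_ceil (w / gridSize n - 1 / 2)]

theorem discreteWidth_lt (w : ℝ) (hn : 0 < n) : discreteWidth w n < w + gridSize n := by
  have hh := gridSize_pos hn
  calc discreteWidth w n < (w / gridSize n + 1) * gridSize n :=
        mul_lt_mul_of_pos_right (by linarith [Int.ceil_lt_add_one (w / gridSize n - 1 / 2)]) hh
    _ = w + gridSize n := by field_simp

theorem exists_isInterior (hn : 0 < n) (hh : gridSize n ≤ (1 - 2 * w) / 3) :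
    ∃ k, IsInterior w n k := by
  let m : Fin n := ⟨n / 2, Nat.div_lt_self hn one_lt_two⟩
  have hlow : 1 ≤ 2 * ((m + 1 / 2) * gridSize n) := by
    have : (n : ℝ) ≤ 2 * m + 1 := by exact_mod_cast (by grind : n ≤ 2 * (n / 2) + 1)
    nlinarith [gridSize_pos hn, natCast_mul_gridSize hn]
  have hupp : 2 * ((m + 1 / 2) * gridSize n) ≤ 1 + gridSize n := by
    have : (2 * m : ℝ) ≤ n := by exact_mod_cast Nat.mul_div_le n 2
    nlinarith [gridSize_pos hn, natCast_mul_gridSize hn]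
  have hwidth := discreteWidth_lt w hn
  have hside : Metric.ball ((m + 1 / 2) * gridSize n) (discreteWidth w n) ⊆ Set.Ioo 0 1 := by
    rw [Real.ball_eq_Ioo]
    exact Set.Ioo_subset_Ioo (by linarith) (by linarith)
  refine ⟨(m, m), ?_⟩
  rw [IsInterior, node, ← ball_prod_same]
  exact Set.prod_mono hside hside

/-- The point of the lattice `h ℤ²` with the coordinates `d`. -/
def latticePoint (n : ℕ) (d : ℤ × ℤ) : ℝ × ℝ := (d.1 * gridSize n, d.2 * gridSize n)

/-- The coordinates of the lattice vector `z_k - z_l`. -/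
def nodeOffset (k l : Fin n × Fin n) : ℤ × ℤ := ((k.1 : ℤ) - l.1, (k.2 : ℤ) - l.2)

theorem nodeOffset_injective (k : Fin n × Fin n) : Function.Injective (nodeOffset k) := by
  intro l l' h
  simp only [nodeOffset, Prod.mk.injEq] at h
  ext <;> lia

theorem node_sub_node (n : ℕ) (k l : Fin n × Fin n) :
    node n k - node n l = latticePoint n (nodeOffset k l) := by
  simp only [node, latticePoint, nodeOffset, Prod.mk_sub_mk]
  push_cast
  ring_nf

theorem norm_latticePoint_lt_discreteWidth (hn : 0 < n) {d : ℤ × ℤ}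
    (hd : ‖latticePoint n d‖ < w + gridSize n / 2) : ‖latticePoint n d‖ < discreteWidth w n := by
  have hh := gridSize_pos hn
  have key {m : ℤ} (hm : ‖m * gridSize n‖ < w + gridSize n / 2) :
      ‖m * gridSize n‖ < discreteWidth w n := by
    rw [norm_mul, Real.norm_of_nonneg hh.le, Int.norm_cast_real, Int.norm_eq_abs] at hm ⊢
    have hceil : |m| - 1 < ⌈w / gridSize n - 1 / 2⌉ := by
      rw [Int.lt_ceil, lt_sub_iff_add_lt, lt_div_iff₀ hh]
      push_cast
      linarith
    have hle : ((|m| : ℤ) : ℝ) ≤ ⌈w / gridSize n - 1 / 2⌉ := by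
      exact_mod_cast Int.le_of_sub_one_lt hceil
    rw [discreteWidth, ← Int.cast_abs]
    gcongr
    linarith
  exact max_lt (key ((le_max_left _ _).trans_lt hd)) (key ((le_max_right _ _).trans_lt hd))

theorem IsInterior.exists_nodeOffset_eq (hk : IsInterior w n k) {d : ℤ × ℤ}
    (hd : ‖latticePoint n d‖ < w + gridSize n / 2) : ∃ l, nodeOffset k l = d := by
  have hn := k.1.pos
  have hmem : node n k - latticePoint n d ∈ unitSquare := hk <| by
    rw [mem_ball_iff_norm, sub_sub_cancel_left, norm_neg]
    exact norm_latticePoint_lt_discreteWidth hn hd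
  have key (i : Fin n) (m : ℤ) (hm : (i + 1 / 2) * gridSize n - m * gridSize n ∈ Set.Ioo 0 1) :
      ∃ j : Fin n, (i : ℤ) - j = m := by
    rw [← sub_mul] at hm
    have hlow : (0 : ℝ) < i + 1 / 2 - m := pos_of_mul_pos_left hm.1 (gridSize_nonneg n)
    have hupp : (i + 1 / 2 - m : ℝ) < n :=
      lt_of_mul_lt_mul_right (hm.2.trans_eq (natCast_mul_gridSize hn).symm) (gridSize_nonneg n)
    have hlow' : m ≤ i := by
      exact_mod_cast Int.lt_add_one_iff.1 (by exact_mod_cast (by linarith : (m : ℝ) < i + 1))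
    have hupp' : (i : ℤ) - m < n := by exact_mod_cast (by linarith : (i - m : ℝ) < n)
    exact ⟨⟨(i - m).toNat, by lia⟩, by rw [Int.toNat_of_nonneg (by lia)]; lia⟩
  obtain ⟨j₁, h₁⟩ := key k.1 d.1 hmem.1
  obtain ⟨j₂, h₂⟩ := key k.2 d.2 hmem.2
  exact ⟨(j₁, j₂), Prod.ext h₁ h₂⟩

/-- The midpoint cubature of `gaussMass`, with the cutoff of `K_h`. It is the sum of the
unnormalized weights `h² G_σ(z_k - z_l)` over `N_k` for every interior node `z_k`. -/
def discreteMass (σ w : ℝ) (n : ℕ) : ℝ :=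
  gridSize n ^ 2 * ∑' d : ℤ × ℤ, cutoffGauss σ (w + gridSize n / 2) (latticePoint n d)

theorem IsInterior.sum_discreteKernel (σ : ℝ) (hk : IsInterior w n k) :
    gridSize n ^ 2 * ∑ l, discreteKernel σ w n k l = discreteMass σ w n := by
  simp only [discreteMass, discreteKernel, node_sub_node]
  rw [← (nodeOffset_injective k).tsum_eq, tsum_fintype]
  exact fun d hd => hk.exists_nodeOffset_eq <| lt_of_not_ge (mt cutoffGauss_of_le_norm hd)

theorem isRenormalization_iff (hσ : σ ≠ 0) (hw : 0 < w) (hk : IsInterior w n k)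
    (hD : discreteMass σ w n ≠ 0) {η : ℝ} :
    IsRenormalization σ w n η ↔
      1 + η = gaussMass σ (discreteWidth w n) * (discreteMass σ w n)⁻¹ := by
  have hM := (gaussMass_pos hσ (hw.trans_le (le_discreteWidth w k.1.pos))).ne'
  have hsum {k : Fin n × Fin n} (hk : IsInterior w n k) :
      ∑ l ∈ neighbours w n k, weight σ w n k l =
        (gaussMass σ (discreteWidth w n))⁻¹ * discreteMass σ w n := by
    simpa only [mul_one, hk.sum_discreteKernel] using
      sum_neighbours_weight_mul σ hw k fun _ => (1 : ℝ)
  have hiff : (1 + η) * ((gaussMass σ (discreteWidth w n))⁻¹ * discreteMass σ w n) = 1 ↔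
      1 + η = gaussMass σ (discreteWidth w n) * (discreteMass σ w n)⁻¹ := by
    field_simp
  have hball (k : Fin n × Fin n) : {y : ℝ × ℝ | ‖y - node n k‖ < discreteWidth w n} =
      Metric.ball (node n k) (discreteWidth w n) := Set.ext fun _ => mem_ball_iff_norm.symm
  rw [← hiff]
  refine ⟨fun h => ?_, fun h k' hk' => ?_⟩
  · rw [← hsum hk]
    exact h k (hball k ▸ hk)
  · rw [hball] at hk'
    rwa [hsum hk']

theorem existsUnique_isRenormalization (hσ : σ ≠ 0) (hw : 0 < w) (hk : IsInterior w n k)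
    (hD : discreteMass σ w n ≠ 0) : ∃! η, IsRenormalization σ w n η := by
  simp only [isRenormalization_iff hσ hw hk hD, ← eq_sub_iff_add_eq']
  exact existsUnique_eq

theorem discreteBlur_eq_integral (hσ : σ ≠ 0) (hw : 0 < w) {k₀ : Fin n × Fin n}
    (hk₀ : IsInterior w n k₀) (hD : discreteMass σ w n ≠ 0) {η : ℝ}
    (hη : IsRenormalization σ w n η) (u : piecewiseConstant n) (hx : x ∈ cell n k) :
    (discreteBlur σ w n η u : ℝ × ℝ → ℝ) x = (discreteMass σ w n)⁻¹ *
      ∫ y, stepFunction n (discreteKernel σ w n k) y * (u : ℝ × ℝ → ℝ) y ∂areaΩ := by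
  have hn := k.1.pos
  have hM := (gaussMass_pos hσ (hw.trans_le (le_discreteWidth w hn))).ne'
  calc (discreteBlur σ w n η u : ℝ × ℝ → ℝ) x
      = (1 + η) * ∑ l ∈ neighbours w n k, weight σ w n k l * (u : ℝ × ℝ → ℝ) (node n l) :=
        stepFunction_of_mem _ hx
    _ = _ := by
        rw [sum_neighbours_weight_mul σ hw, ← integral_stepFunction_mul hn,
          (isRenormalization_iff hσ hw hk₀ hD).1 hη]
        field_simp

end Renormalization

section Estimates

theorem kernelErrorConst_pos (hσ : σ ≠ 0) (hw : 0 < w) : 0 < kernelErrorConst σ w := by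
  unfold kernelErrorConst; positivity

theorem IsInterior.abs_gaussMass_sub_discreteMass_le (σ : ℝ) (hk : IsInterior w n k)
    (hhw : 2 * gridSize n ≤ w) :
    |gaussMass σ w - discreteMass σ w n| ≤ kernelErrorConst σ w * gridSize n := by
  have hn := k.1.pos
  have hh := gridSize_pos hn
  have hw₀ : 0 ≤ w := by linarith
  have hM : ∫ y, cutoffGauss σ w (node n k - y) ∂areaΩ = gaussMass σ w :=
    integral_cutoffGauss_sub σ ((Metric.ball_subset_ball (le_discreteWidth w hn)).trans hk)
  have hconst : 0 ≤ kernelErrorConst σ w * gridSize n := by unfold kernelErrorConst; positivity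
  rw [← ENNReal.ofReal_le_ofReal_iff hconst, ← Real.enorm_eq_ofReal_abs, ← hM,
    ← hk.sum_discreteKernel, ← integral_stepFunction, ← integral_sub
      ((memLp_cutoffGauss_sub σ w _ 1).integrable le_rfl)
      ((memLp_stepFunction _ 1).integrable le_rfl)]
  calc ‖∫ y, (cutoffGauss σ w (node n k - y) -
          stepFunction n (discreteKernel σ w n k) y) ∂areaΩ‖ₑ
      ≤ ∫⁻ y, ‖cutoffGauss σ w (node n k - y) -
          stepFunction n (discreteKernel σ w n k) y‖ₑ ∂areaΩ := enorm_integral_le_lintegral_enorm _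
    _ ≤ ∫⁻ y, kernelError σ w (gridSize n) (node n k - y) ∂areaΩ := by
        refine lintegral_mono_ae ((ae_mem_cell hn).mono ?_)
        rintro y ⟨l, hy⟩
        rw [stepFunction_of_mem _ hy]
        exact enorm_cutoffGauss_sub_discreteKernel_le σ (by linarith) (node_mem_cell n k) hy
    _ ≤ ENNReal.ofReal (kernelErrorConst σ w * gridSize n) :=
        lintegral_kernelError_sub_le σ hh.le hhw _

/-- The bound `h₀` on the grid size: it makes the cutoff at `w` wider than two cells, provides an
interior node, and keeps `discreteMass` above half of `gaussMass`. -/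
def maxGridSize (σ w : ℝ) : ℝ :=
  min (w / 2) (min ((1 - 2 * w) / 3) (gaussMass σ w / (2 * kernelErrorConst σ w)))

theorem maxGridSize_pos (hσ : σ ≠ 0) (hw : 0 < w) (hw' : w < 1 / 2) : 0 < maxGridSize σ w :=
  lt_min (by positivity) <| lt_min (by linarith) <|
    div_pos (gaussMass_pos hσ hw) (mul_pos two_pos (kernelErrorConst_pos hσ hw))

theorem two_mul_gridSize_le (hh : gridSize n ≤ maxGridSize σ w) : 2 * gridSize n ≤ w := by
  linarith [hh.trans (min_le_left _ _)]

theorem exists_isInterior_and_half_gaussMass_le (hσ : σ ≠ 0) (hw : 0 < w) (hn : 0 < n)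
    (hh : gridSize n ≤ maxGridSize σ w) :
    ∃ k, IsInterior w n k ∧ gaussMass σ w / 2 ≤ discreteMass σ w n := by
  obtain ⟨-, hboundary, hmass⟩ := (le_min_iff.1 hh).imp_right le_min_iff.1
  obtain ⟨k, hk⟩ := exists_isInterior hn hboundary
  rw [le_div_iff₀ (mul_pos two_pos (kernelErrorConst_pos hσ hw))] at hmass
  have hdiff := (abs_le.1 <|
    hk.abs_gaussMass_sub_discreteMass_le σ (two_mul_gridSize_le hh)).2
  exact ⟨k, hk, by linarith⟩

/-- The bound of the kernel of `K_h`. -/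
def stabilityConst (σ w : ℝ) : ℝ := 2 * (gaussMass σ w)⁻¹ * (σ ^ 2)⁻¹

theorem stabilityConst_pos (hσ : σ ≠ 0) (hw : 0 < w) : 0 < stabilityConst σ w := by
  have := gaussMass_pos hσ hw
  unfold stabilityConst; positivity

theorem enorm_inv_discreteMass_mul_discreteKernel_le (hM : 0 < gaussMass σ w)
    (hD : gaussMass σ w / 2 ≤ discreteMass σ w n) (k l : Fin n × Fin n) :
    ‖(discreteMass σ w n)⁻¹ * discreteKernel σ w n k l‖ₑ ≤ ENNReal.ofReal (stabilityConst σ w) := by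
  have hD₀ : 0 < discreteMass σ w n := by linarith
  have hinv : (discreteMass σ w n)⁻¹ ≤ 2 * (gaussMass σ w)⁻¹ := by
    rw [← div_eq_mul_inv, ← inv_div]
    exact inv_anti₀ (by positivity) hD
  obtain ⟨hnonneg, hle⟩ := cutoffGauss_mem_Icc σ (w + gridSize n / 2) (node n k - node n l)
  rw [discreteKernel, Real.enorm_of_nonneg (mul_nonneg (by positivity) hnonneg)]
  exact ENNReal.ofReal_le_ofReal (mul_le_mul hinv hle hnonneg (by positivity))

/-- A common bound of the difference of the kernels of `K^{σ,w}` and `K_h` at points `x` and `y`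
of two cells with `z = x - y`. The second summand accounts for the difference of the masses. -/
def blurError (σ w h : ℝ) (z : ℝ × ℝ) : ℝ≥0∞ :=
  ENNReal.ofReal (gaussMass σ w)⁻¹ * (kernelError σ w h z +
    ENNReal.ofReal (kernelErrorConst σ w * h * stabilityConst σ w))

/-- The factor of `h` in the integral of `blurError`. -/
def approximationConst (σ w : ℝ) : ℝ :=
  (gaussMass σ w)⁻¹ * (kernelErrorConst σ w * (1 + stabilityConst σ w))

theorem measurable_blurError (σ w h : ℝ) : Measurable (blurError σ w h) :=
  ((measurable_kernelError σ w h).add_const _).const_mul _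

theorem blurError_neg (σ w h : ℝ) (z : ℝ × ℝ) : blurError σ w h (-z) = blurError σ w h z := by
  rw [blurError, kernelError_neg, blurError]

theorem lintegral_blurError_sub_le (hσ : σ ≠ 0) (hw : 0 < w) (hh : 0 ≤ h) (hhw : 2 * h ≤ w)
    (x : ℝ × ℝ) :
    ∫⁻ y, blurError σ w h (x - y) ∂areaΩ ≤ ENNReal.ofReal (approximationConst σ w * h) := by
  have hM := gaussMass_pos hσ hw
  have hE := kernelErrorConst_pos hσ hw
  have hS := stabilityConst_pos hσ hw
  have hmeas : Measurable fun y => kernelError σ w h (x - y) :=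
    (measurable_kernelError σ w h).comp (measurable_const_sub x)
  calc ∫⁻ y, blurError σ w h (x - y) ∂areaΩ
      = ENNReal.ofReal (gaussMass σ w)⁻¹ * (∫⁻ y, kernelError σ w h (x - y) ∂areaΩ +
          ENNReal.ofReal (kernelErrorConst σ w * h * stabilityConst σ w)) := by
        simp only [blurError]
        rw [lintegral_const_mul _ (hmeas.add_const _), lintegral_add_left hmeas, lintegral_const,
          measure_univ, mul_one]
    _ ≤ ENNReal.ofReal (gaussMass σ w)⁻¹ * (ENNReal.ofReal (kernelErrorConst σ w * h) +
          ENNReal.ofReal (kernelErrorConst σ w * h * stabilityConst σ w)) := by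
        gcongr
        exact lintegral_kernelError_sub_le σ hh hhw x
    _ = ENNReal.ofReal (approximationConst σ w * h) := by
        rw [← ENNReal.ofReal_add (by positivity) (by positivity),
          ← ENNReal.ofReal_mul (by positivity), approximationConst]
        ring_nf

theorem enorm_blurKernel_sub_le (hσ : σ ≠ 0) (hw : 0 < w) (hh : gridSize n ≤ maxGridSize σ w)
    (hx : x ∈ cell n k) (hy : y ∈ cell n l) :
    ‖(gaussMass σ w)⁻¹ * cutoffGauss σ w (x - y) -
        (discreteMass σ w n)⁻¹ * discreteKernel σ w n k l‖ₑ ≤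
      blurError σ w (gridSize n) (x - y) := by
  have hM := gaussMass_pos hσ hw
  have hE := kernelErrorConst_pos hσ hw
  have hhw := two_mul_gridSize_le hh
  obtain ⟨k₀, hk₀, hD⟩ := exists_isInterior_and_half_gaussMass_le hσ hw k.1.pos hh
  have hD₀ : discreteMass σ w n ≠ 0 := by linarith
  have hsplit : (gaussMass σ w)⁻¹ * cutoffGauss σ w (x - y) -
        (discreteMass σ w n)⁻¹ * discreteKernel σ w n k l =
      (gaussMass σ w)⁻¹ * ((cutoffGauss σ w (x - y) - discreteKernel σ w n k l) -
        (gaussMass σ w - discreteMass σ w n) *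
          ((discreteMass σ w n)⁻¹ * discreteKernel σ w n k l)) := by
    field_simp
    ring
  rw [hsplit, enorm_mul, Real.enorm_of_nonneg (by positivity), blurError]
  gcongr
  refine enorm_sub_le.trans (add_le_add ?_ ?_)
  · exact enorm_cutoffGauss_sub_discreteKernel_le σ (by linarith [gridSize_nonneg n]) hx hy
  · rw [enorm_mul, ENNReal.ofReal_mul (mul_nonneg hE.le (gridSize_nonneg n)),
      Real.enorm_eq_ofReal_abs]
    gcongr
    · exact hk₀.abs_gaussMass_sub_discreteMass_le σ hhw
    · exact enorm_inv_discreteMass_mul_discreteKernel_le hM hD k l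

theorem enorm_blur_sub_discreteBlur_le (hσ : σ ≠ 0) (hw : 0 < w)
    (hh : gridSize n ≤ maxGridSize σ w) {η : ℝ} (hη : IsRenormalization σ w n η)
    (u : piecewiseConstant n) (hx : x ∈ cell n k) :
    ‖blur σ w u x - (discreteBlur σ w n η u : ℝ × ℝ → ℝ) x‖ₑ ≤
      ∫⁻ y, blurError σ w (gridSize n) (x - y) * ‖(u : ℝ × ℝ → ℝ) y‖ₑ ∂areaΩ := by
  have hn := k.1.pos
  have hM := gaussMass_pos hσ hw
  obtain ⟨k₀, hk₀, hD⟩ := exists_isInterior_and_half_gaussMass_le hσ hw hn hh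
  have hu := memLp_piecewiseConstant u 2
  have hblur : Integrable (fun y => cutoffGauss σ w (x - y) * (u : ℝ × ℝ → ℝ) y) areaΩ :=
    (memLp_cutoffGauss_sub σ w x 2).integrable_mul hu
  have hdiscrete : Integrable (fun y => stepFunction n (discreteKernel σ w n k) y *
      (u : ℝ × ℝ → ℝ) y) areaΩ := (memLp_stepFunction _ 2).integrable_mul hu
  rw [blur_eq_integral, discreteBlur_eq_integral hσ hw hk₀ (by linarith) hη u hx,
    ← integral_const_mul, ← integral_const_mul,
    ← integral_sub (hblur.const_mul _) (hdiscrete.const_mul _)]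
  refine (enorm_integral_le_lintegral_enorm _).trans
    (lintegral_mono_ae ((ae_mem_cell hn).mono ?_))
  rintro y ⟨l, hy⟩
  rw [stepFunction_of_mem _ hy, ← mul_assoc, ← mul_assoc, ← sub_mul, enorm_mul]
  gcongr
  exact enorm_blurKernel_sub_le hσ hw hh hx hy

theorem eLpNorm_blur_sub_discreteBlur_le (hσ : σ ≠ 0) (hw : 0 < w) (hn : 0 < n)
    (hh : gridSize n ≤ maxGridSize σ w) {η : ℝ} (hη : IsRenormalization σ w n η)
    (u : piecewiseConstant n) :
    eLpNorm (blur σ w u - (discreteBlur σ w n η u : ℝ × ℝ → ℝ)) 2 areaΩ ≤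
      ENNReal.ofReal (approximationConst σ w * gridSize n) *
        eLpNorm (u : ℝ × ℝ → ℝ) 2 areaΩ := by
  have hrow (x : ℝ × ℝ) := lintegral_blurError_sub_le hσ hw (gridSize_nonneg n)
    (two_mul_gridSize_le hh) x
  have hcol (y : ℝ × ℝ) : ∫⁻ x, blurError σ w (gridSize n) (x - y) ∂areaΩ ≤
      ENNReal.ofReal (approximationConst σ w * gridSize n) := by
    simpa only [← blurError_neg σ w _ (_ - y), neg_sub] using hrow y
  have schur := eLpNorm_le_of_enorm_le_lintegral_mul (p := 2) one_le_two
    (κ := fun x y => blurError σ w (gridSize n) (x - y))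
    ((measurable_blurError σ w _).comp measurable_sub) hrow hcol
    (memLp_piecewiseConstant u 2).aestronglyMeasurable
    (v := blur σ w u - (discreteBlur σ w n η u : ℝ × ℝ → ℝ))
    ((ae_mem_cell hn).mono fun x ⟨k, hx⟩ => enorm_blur_sub_discreteBlur_le hσ hw hh hη u hx)
  rwa [← ENNReal.rpow_add_of_nonneg _ _ (by norm_num) (by norm_num), sub_add_cancel,
    ENNReal.rpow_one] at schur

theorem eLpNorm_top_discreteBlur_le (hσ : σ ≠ 0) (hw : 0 < w) (hn : 0 < n)
    (hh : gridSize n ≤ maxGridSize σ w) {η : ℝ} (hη : IsRenormalization σ w n η)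
    (u : piecewiseConstant n) :
    eLpNorm (discreteBlur σ w n η u : ℝ × ℝ → ℝ) ∞ areaΩ ≤
      ENNReal.ofReal (stabilityConst σ w) * eLpNorm (u : ℝ × ℝ → ℝ) 2 areaΩ := by
  have hM := gaussMass_pos hσ hw
  obtain ⟨k₀, hk₀, hD⟩ := exists_isInterior_and_half_gaussMass_le hσ hw hn hh
  have hu := (memLp_piecewiseConstant u 2).aestronglyMeasurable
  rw [eLpNorm_exponent_top]
  refine eLpNormEssSup_le_of_ae_enorm_bound ((ae_mem_cell hn).mono ?_)
  rintro x ⟨k, hx⟩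
  calc ‖(discreteBlur σ w n η u : ℝ × ℝ → ℝ) x‖ₑ
      ≤ ∫⁻ y, ‖(discreteMass σ w n)⁻¹ *
          (stepFunction n (discreteKernel σ w n k) y * (u : ℝ × ℝ → ℝ) y)‖ₑ ∂areaΩ := by
        rw [discreteBlur_eq_integral hσ hw hk₀ (by linarith) hη u hx, ← integral_const_mul]
        exact enorm_integral_le_lintegral_enorm _
    _ ≤ ∫⁻ y, ENNReal.ofReal (stabilityConst σ w) * ‖(u : ℝ × ℝ → ℝ) y‖ₑ ∂areaΩ := by
        refine lintegral_mono_ae ((ae_mem_cell hn).mono ?_)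
        rintro y ⟨l, hy⟩
        rw [stepFunction_of_mem _ hy, ← mul_assoc, enorm_mul]
        gcongr
        exact enorm_inv_discreteMass_mul_discreteKernel_le hM hD k l
    _ = ENNReal.ofReal (stabilityConst σ w) * eLpNorm (u : ℝ × ℝ → ℝ) 1 areaΩ := by
        rw [lintegral_const_mul'' _ hu.enorm, eLpNorm_one_eq_lintegral_enorm]
    _ ≤ ENNReal.ofReal (stabilityConst σ w) * eLpNorm (u : ℝ × ℝ → ℝ) 2 areaΩ := by
        gcongr
        exact eLpNorm_le_eLpNorm_of_exponent_le one_le_two hu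

end Estimates

end GaussianBlur

end

theorem theoremA4 (σ w : ℝ) (hσ : 0 < σ) (hw : 0 < w) (hw' : w < 1 / 2) :
    ∃ C : ℝ, 0 < C ∧ ∃ h₀ : ℝ, 0 < h₀ ∧
      (∀ n : ℕ, 0 < n → GaussianBlur.gridSize n ≤ h₀ →
        (∃! η : ℝ, GaussianBlur.IsRenormalization σ w n η) ∧
        ∀ η : ℝ, GaussianBlur.IsRenormalization σ w n η →
          ∀ u : GaussianBlur.piecewiseConstant n,
            eLpNorm (GaussianBlur.blur σ w (u : ℝ × ℝ → ℝ) -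
                (GaussianBlur.discreteBlur σ w n η u : ℝ × ℝ → ℝ)) 2 GaussianBlur.areaΩ ≤
              ENNReal.ofReal (C * GaussianBlur.gridSize n) *
                eLpNorm (u : ℝ × ℝ → ℝ) 2 GaussianBlur.areaΩ ∧
            eLpNorm (GaussianBlur.discreteBlur σ w n η u : ℝ × ℝ → ℝ) ∞ GaussianBlur.areaΩ ≤
              ENNReal.ofReal C * eLpNorm (u : ℝ × ℝ → ℝ) 2 GaussianBlur.areaΩ) ∧
      (∀ (n : ℕ → ℕ) (η : ℕ → ℝ),
        (∀ j, 0 < n j ∧ GaussianBlur.gridSize (n j) ≤ h₀ ∧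
          GaussianBlur.IsRenormalization σ w (n j) (η j)) →
        GaussianBlur.SmoothedApproximation (GaussianBlur.blur σ w)
            (fun j => GaussianBlur.piecewiseConstant (n j))
            (fun j => GaussianBlur.discreteBlur σ w (n j) (η j))
            (fun j => GaussianBlur.gridSize (n j)) C ∧
          GaussianBlur.L2LinftyStability
            (fun j => GaussianBlur.piecewiseConstant (n j))
            (fun j => GaussianBlur.discreteBlur σ w (n j) (η j)) C) := by
  open GaussianBlur in
  have hσ₀ := hσ.ne'
  let C := max (approximationConst σ w) (stabilityConst σ w)
  have estimates {n : ℕ} (hn : 0 < n) (hh : gridSize n ≤ maxGridSize σ w) {η : ℝ}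
      (hη : IsRenormalization σ w n η) (u : piecewiseConstant n) :
      eLpNorm (blur σ w u - (discreteBlur σ w n η u : ℝ × ℝ → ℝ)) 2 areaΩ ≤
          ENNReal.ofReal (C * gridSize n) * eLpNorm (u : ℝ × ℝ → ℝ) 2 areaΩ ∧
        eLpNorm (discreteBlur σ w n η u : ℝ × ℝ → ℝ) ∞ areaΩ ≤
          ENNReal.ofReal C * eLpNorm (u : ℝ × ℝ → ℝ) 2 areaΩ := by
    have happrox := eLpNorm_blur_sub_discreteBlur_le hσ₀ hw hn hh hη u
    have hstable := eLpNorm_top_discreteBlur_le hσ₀ hw hn hh hη u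
    refine ⟨happrox.trans ?_, hstable.trans ?_⟩ <;> gcongr
    exacts [gridSize_nonneg n, le_max_left _ _, le_max_right _ _]
  refine ⟨C, lt_max_of_lt_right (stabilityConst_pos hσ₀ hw), maxGridSize σ w,
    maxGridSize_pos hσ₀ hw hw', fun n hn hh => ⟨?_, fun η hη => estimates hn hh hη⟩,
    fun n η hgrid => ⟨fun j u => ?_, fun j u => ?_⟩⟩
  · obtain ⟨k, hk, hD⟩ := exists_isInterior_and_half_gaussMass_le hσ₀ hw hn hh
    exact existsUnique_isRenormalization hσ₀ hw hk (by linarith [gaussMass_pos hσ₀ hw])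
  · exact (estimates (hgrid j).1 (hgrid j).2.1 (hgrid j).2.2 u).1
  · exact (estimates (hgrid j).1 (hgrid j).2.1 (hgrid j).2.2 u).2
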